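/- Let $\mathcal H$ be a complex Hilbert space and let $A$ be a bounded positive operator on $\mathcal H$ with closed range. Write $\langle x,y\rangle_A=\langle Ax,y\rangle$ and $\|x\|_A=\langle x,x\rangle_A^{1/2}$. A bounded operator $T$ on $\mathcal H$ is called - $A$-bounded if there is $c>0$ with $\|Tx\|_A\le c\|x\|_A$ for all $x\in\mathcal H$; - $A$-normal if it has an $A$-adjoint (a bounded operator $W$ with $\langle Tx,y\rangle_A=\langle x,Wy\rangle_A$ for all $x,y$) and $AT^{\sharp_A}T=ATT^{\sharp_A}$, where $T^{\sharp_A}$ is the unique $A$-adjoint of $T$ with range in $\overline{R(A)}$; - $A$-compact if it is $A$-bounded and, for every sequence $(x_n)$ in $\mathcal H$ with $\sup_n\|x_n\|_A<\infty$, there are a subsequence $(x_{n_k})$ and $y\in\mathcal H$ with $\|Tx_{n_k}-y\|_A\to0$; - $A$-Fredholm if it is $A$-bounded and there are an $A$-bounded operator $S$ and $A$-compact operators $K_1,K_2$ with $ATS-A=AK_1$ and $AST-A=AK_2$. For an $A$-bounded operator $T$ put $$W_A(T)=\{\langle Tx,x\rangle_A : x\in\mathcal H,\ \|x\|_A=1\},\qquad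 \sigma_{A,\mathrm{ess}}(T)=\{\lambda\in\mathbb C : T-\lambda I \text{ is not } A\text{-Fredholm}\},$$ and let $\mathbb D=\{z\in\mathbb C:|z|<1\}$. **Theorem.** Let $T$ be an $A$-bounded operator on $\mathcal H$ with $T=N+K$, where $N$ is $A$-normal and $K$ is $A$-compact. If $W_A(T)\subseteq\overline{\mathbb D}$, $\sigma_{A,\mathrm{ess}}(T)\subseteq\mathbb D$, and $\overline{W_A(T)}\cap\partial\mathbb D$ is an infinite set, then $W_A(T)=\overline{\mathbb D}$. -/

import Mathlib

open Filter Topology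

noncomputable section

namespace SemiHilbert

variable {H : Type*} [NormedAddCommGroup H] [InnerProductSpace ℂ H]

/-- The semi-inner product `⟨x, y⟩_A = ⟨A x, y⟩`, linear in `x` and conjugate-linear in `y`
(Mathlib's `inner` is conjugate-linear in its first argument). -/
def aInner (A : H →L[ℂ] H) (x y : H) : ℂ := inner ℂ y (A x)

/-- The seminorm `‖x‖_A = √⟨x, x⟩_A`. -/
def aNorm (A : H →L[ℂ] H) (x : H) : ℝ := Real.sqrt (aInner A x x).re

/-- `T` is `A`-bounded: `‖T x‖_A ≤ c ‖x‖_A` for some `c > 0` and all `x`. -/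
def IsABounded (A T : H →L[ℂ] H) : Prop :=
  ∃ c : ℝ, 0 < c ∧ ∀ x, aNorm A (T x) ≤ c * aNorm A x

/-- `W` is an `A`-adjoint of `T`. -/
def IsAAdjoint (A T W : H →L[ℂ] H) : Prop :=
  ∀ x y, aInner A (T x) y = aInner A x (W y)

/-- `S` is the distinguished `A`-adjoint `T^♯` of `T`: the `A`-adjoint whose range lies in the
closure of the range of `A`. -/
def IsSharp (A T S : H →L[ℂ] H) : Prop :=
  IsAAdjoint A T S ∧ ∀ x, S x ∈ closure (Set.range A)

/-- `T` admits an `A`-adjoint, and `A T^♯ T = A T T^♯`. -/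
def IsANormal (A T : H →L[ℂ] H) : Prop :=
  ∃ S : H →L[ℂ] H, IsSharp A T S ∧ A ∘L S ∘L T = A ∘L T ∘L S

/-- `T` is `A`-compact: it is `A`-bounded, and for every `A`-bounded sequence `x`, the sequence
`T (x n)` has a subsequence that converges in the seminorm `‖·‖_A` to a point of `H`. -/
def IsACompact (A T : H →L[ℂ] H) : Prop :=
  IsABounded A T ∧
    ∀ x : ℕ → H, (∃ M : ℝ, ∀ n, aNorm A (x n) ≤ M) →
      ∃ (y : H) (φ : ℕ → ℕ), StrictMono φ ∧
        Tendsto (fun n => aNorm A (T (x (φ n)) - y)) atTop (𝓝 0)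

/-- `T` is `A`-Fredholm: invertible modulo `A`-compact operators, up to `A`. -/
def IsAFredholm (A T : H →L[ℂ] H) : Prop :=
  IsABounded A T ∧
    ∃ S K₁ K₂ : H →L[ℂ] H, IsABounded A S ∧ IsACompact A K₁ ∧ IsACompact A K₂ ∧
      A ∘L T ∘L S - A = A ∘L K₁ ∧ A ∘L S ∘L T - A = A ∘L K₂

/-- The `A`-essential spectrum. -/
def aEssSpectrum (A T : H →L[ℂ] H) : Set ℂ :=
  {z | ¬ IsAFredholm A (T - z • ContinuousLinearMap.id ℂ H)}

/-- The `A`-numerical range. -/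
def aNumRange (A T : H →L[ℂ] H) : Set ℂ :=
  {w | ∃ x : H, aNorm A x = 1 ∧ aInner A (T x) x = w}

/-- The operator `T^♯` is unique, so `IsANormal` does not depend on a choice. -/
theorem IsSharp.unique {A T S S' : H →L[ℂ] H}
    (h : IsSharp A T S) (h' : IsSharp A T S') : S = S' := by
  ext y
  have h0 : ∀ x, inner ℂ (S y - S' y) (A x) = (0 : ℂ) := by
    intro x
    have e : aInner A x (S y) = aInner A x (S' y) := by rw [← h.1 x y, ← h'.1 x y]
    simp only [aInner] at e
    rw [inner_sub_left, e, sub_self]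
  have hcl : ∀ z ∈ closure (Set.range A), inner ℂ (S y - S' y) z = (0 : ℂ) := by
    intro z hz
    have hc : IsClosed {z : H | inner ℂ (S y - S' y) z = (0 : ℂ)} :=
      isClosed_eq (by fun_prop) continuous_const
    refine closure_minimal ?_ hc hz
    rintro _ ⟨x, rfl⟩
    exact h0 x
  have : inner ℂ (S y - S' y) (S y - S' y) = (0 : ℂ) := by
    rw [inner_sub_right, hcl _ (h.2 y), hcl _ (h'.2 y), sub_self]
  exact sub_eq_zero.mp (inner_self_eq_zero.mp this)

end SemiHilbert

end

/-! Closed range of `A` makes the range `E` of `Q = √A` a Hilbert space, and `Q : H → E` is a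
surjection carrying `⟨·,·⟩_A` to the inner product of `E`. All the data descend to `E`, where the
claim is Anderson's theorem for a normal plus a compact operator.

On `E`, the functional calculus splits the normal part into a strict contraction plus a compact
operator (`exists_norm_lt_one_add_isCompactOperator`). Approximating the total compact part by
finite rank gives `T = L + F` with `‖L‖ < 1` and `F` of finite rank. Since the numerical range lies
in the closed disc, `1 - Re(e^{-iθ}T) ≥ 0`, and `e^{iθ}` is in the closure of that range only if
this operator has approximate null vectors. It is an invertible operator minus one of finite rank,
so they yield a genuine null vector, detected by the vanishing of a determinant real analytic in
`θ`. Infinitely many zeros in `[-π, π]` force it to vanish identically. Hence the numerical range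
contains the whole circle, and by convexity the disc. -/

namespace SemiHilbert

/-! ### Convexity of the numerical range; finite-rank approximation. -/

section Hilbert

variable {E : Type*} [NormedAddCommGroup E] [InnerProductSpace ℂ E]

/-- The classical numerical range of a bounded operator. -/
def numRange (T : E →L[ℂ] E) : Set ℂ := {w | ∃ x : E, ‖x‖ = 1 ∧ inner ℂ x (T x) = w}

theorem inner_div_mem_numRange (T : E →L[ℂ] E) {z : E} (hz : z ≠ 0) :
    inner ℂ z (T z) / ((‖z‖ ^ 2 : ℝ) : ℂ) ∈ numRange T := by
  have hz' : (‖z‖ : ℂ) ≠ 0 := by simpa using hz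
  refine ⟨((‖z‖⁻¹ : ℝ) : ℂ) • z, ?_, ?_⟩
  · rw [norm_smul, Complex.norm_real, norm_inv, norm_norm, inv_mul_cancel₀ (norm_ne_zero_iff.2 hz)]
  · rw [map_smul, inner_smul_left, inner_smul_right, Complex.conj_ofReal]
    push_cast
    field_simp

/-- A phase that makes the cross terms of a quadratic form real. -/
theorem exists_phase_im_eq_zero (p q : ℂ) :
    ∃ μ : ℂ, ‖μ‖ = 1 ∧ (μ * p + starRingEnd ℂ μ * q).im = 0 := by
  have key : ∀ μ : ℂ, (μ * p + starRingEnd ℂ μ * q).im = (μ * (p - starRingEnd ℂ q)).im := by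
    intro μ
    simp [Complex.mul_im]
    ring
  by_cases h : p - starRingEnd ℂ q = 0
  · exact ⟨1, by simp, by rw [key, h]; simp⟩
  · set c := p - starRingEnd ℂ q
    have hc : (‖c‖ : ℂ) ≠ 0 := by simpa using h
    refine ⟨starRingEnd ℂ c / ‖c‖, ?_, ?_⟩
    · rw [norm_div, RCLike.norm_conj, Complex.norm_real, norm_norm,
        div_self (norm_ne_zero_iff.2 h)]
    · rw [key]
      have : starRingEnd ℂ c / ‖c‖ * c = ((‖c‖ : ℝ) : ℂ) := by
        rw [div_mul_eq_mul_div, Complex.conj_mul']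
        field_simp
      rw [this, Complex.ofReal_im]

/-- Convexity reduces to this case by an affine change of the operator. Along the segment from `μ x`
to `y` the phase `μ` keeps the Rayleigh quotient real, and it runs continuously from 0 to 1. -/
theorem ofReal_mem_numRange_of_zero_one_mem (T : E →L[ℂ] E) (h0 : (0 : ℂ) ∈ numRange T)
    (h1 : (1 : ℂ) ∈ numRange T) {s : ℝ} (hs : s ∈ Set.Icc (0 : ℝ) 1) :
    (s : ℂ) ∈ numRange T := by
  obtain ⟨x, hx, hTx⟩ := h0
  obtain ⟨y, hy, hTy⟩ := h1
  obtain ⟨μ, hμ, him⟩ := exists_phase_im_eq_zero (inner ℂ y (T x)) (inner ℂ x (T y))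
  have hμμ : starRingEnd ℂ μ * μ = 1 := by rw [Complex.conj_mul', hμ]; simp
  have hμ0 : μ ≠ 0 := by rintro rfl; simp at hμ
  let z : ℝ → E := fun t => ((1 - t : ℝ) : ℂ) • (μ • x) + (t : ℂ) • y
  -- A zero would make `y` a multiple of `x`, forcing the form at `y` to be 0 instead of 1.
  have hzne : ∀ t, z t ≠ 0 := by
    intro t ht
    have hx0 : x ≠ 0 := by rintro rfl; simp at hx
    have hy0 : y ≠ 0 := by rintro rfl; simp at hy
    rcases eq_or_ne t 0 with rfl | ht0
    · simp [z, hμ0, hx0] at ht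
    · have hyx : y = (-((t : ℂ)⁻¹ * ((1 - t : ℝ) : ℂ) * μ)) • x := by
        have ht0' : (t : ℂ) ≠ 0 := by exact_mod_cast ht0
        have : (t : ℂ) • y = -(((1 - t : ℝ) : ℂ) • (μ • x)) := by
          rw [eq_neg_iff_add_eq_zero, add_comm]; exact ht
        rw [← inv_smul_smul₀ ht0' y, this]
        simp only [smul_neg, neg_smul, smul_smul, mul_assoc]
      rw [hyx, map_smul, inner_smul_left, inner_smul_right, hTx] at hTy
      simp at hTy
  have hq : ∀ t, inner ℂ (z t) (T (z t)) =
      ((t ^ 2 + t * (1 - t) *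
        (μ * inner ℂ y (T x) + starRingEnd ℂ μ * inner ℂ x (T y)).re : ℝ) : ℂ) := by
    intro t
    have hre : (((μ * inner ℂ y (T x) + starRingEnd ℂ μ * inner ℂ x (T y)).re : ℝ) : ℂ) =
        μ * inner ℂ y (T x) + starRingEnd ℂ μ * inner ℂ x (T y) := by
      apply Complex.ext <;> simp only [Complex.ofReal_re, Complex.ofReal_im, him]
    push_cast [hre]
    simp only [z, map_add, map_smul, inner_add_left, inner_add_right, inner_smul_left,
      inner_smul_right, Complex.conj_ofReal, hTx, hTy]
    push_cast
    ring
  let f : ℝ → ℝ := fun t => (t ^ 2 + t * (1 - t) *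
        (μ * inner ℂ y (T x) + starRingEnd ℂ μ * inner ℂ x (T y)).re) / ‖z t‖ ^ 2
  have hfc : Continuous f := by
    refine Continuous.div (by fun_prop) (by fun_prop) fun t => ?_
    exact pow_ne_zero 2 (norm_ne_zero_iff.2 (hzne t))
  have hf0 : f 0 = 0 := by simp [f]
  have hf1 : f 1 = 1 := by simp [f, z, hy]
  obtain ⟨t, -, ht⟩ := intermediate_value_Icc (zero_le_one' ℝ) hfc.continuousOn
    (by rw [hf0, hf1]; exact hs)
  have := inner_div_mem_numRange T (hzne t)
  rw [hq, ← Complex.ofReal_div] at this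
  rwa [← ht]

/-- The Toeplitz–Hausdorff theorem. -/
theorem convex_numRange (T : E →L[ℂ] E) : Convex ℝ (numRange T) := by
  rw [convex_iff_segment_subset]
  intro a ha b hb w hw
  rw [segment_eq_image'] at hw
  obtain ⟨s, hs, rfl⟩ := hw
  rcases eq_or_ne a b with rfl | hab
  · simpa using ha
  have hba : b - a ≠ 0 := sub_ne_zero.2 hab.symm
  let T' : E →L[ℂ] E := (b - a)⁻¹ • (T - a • ContinuousLinearMap.id ℂ E)
  have hT' : ∀ x : E, ‖x‖ = 1 → inner ℂ x (T' x) = (b - a)⁻¹ * (inner ℂ x (T x) - a) := by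
    intro x hx
    simp [T', hx]
  have h0 : (0 : ℂ) ∈ numRange T' := by
    obtain ⟨x, hx, hTx⟩ := ha
    exact ⟨x, hx, by rw [hT' x hx, hTx]; simp⟩
  have h1 : (1 : ℂ) ∈ numRange T' := by
    obtain ⟨x, hx, hTx⟩ := hb
    exact ⟨x, hx, by rw [hT' x hx, hTx, inv_mul_cancel₀ hba]⟩
  obtain ⟨x, hx, hTx⟩ := ofReal_mem_numRange_of_zero_one_mem T' h0 h1 hs
  refine ⟨x, hx, ?_⟩
  rw [hT' x hx, inv_mul_eq_iff_eq_mul₀ hba] at hTx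
  simp only [Complex.real_smul]
  linear_combination hTx

/-- A compact operator is approximated in norm by its compressions to finite-dimensional ranges. -/
theorem exists_finiteDimensional_norm_sub_starProjection_comp_le {C : E →L[ℂ] E}
    (hC : IsCompactOperator C) {ε : ℝ} (hε : 0 < ε) :
    ∃ (V : Submodule ℂ E) (_ : FiniteDimensional ℂ V), ‖C - V.starProjection ∘L C‖ ≤ ε := by
  have hcomp := hC.isCompact_closure_image_closedBall 1
  obtain ⟨t, -, htf, hcov⟩ := totallyBounded_iff_subset.1
    (hcomp.totallyBounded.subset subset_closure) _ (Metric.dist_mem_uniformity hε)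
  let V : Submodule ℂ E := Submodule.span ℂ t
  have : FiniteDimensional ℂ V := FiniteDimensional.span_of_finite ℂ htf
  refine ⟨V, inferInstance, ContinuousLinearMap.opNorm_le_of_unit_norm hε.le fun x hx => ?_⟩
  have hmem : C x ∈ C '' Metric.closedBall 0 1 := ⟨x, by simp [hx], rfl⟩
  obtain ⟨y, hyt, hy⟩ := Set.mem_iUnion₂.1 (hcov hmem)
  have hy' : ‖C x - y‖ < ε := by rw [← dist_eq_norm]; exact hy
  have hmin : ‖C x - V.starProjection (C x)‖ ≤ ‖C x - y‖ := by
    rw [Submodule.starProjection_minimal]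
    exact ciInf_le ⟨0, by rintro _ ⟨v, rfl⟩; positivity⟩ (⟨y, Submodule.subset_span hyt⟩ : V)
  exact hmin.trans hy'.le

/-! ### Normal operators modulo compact operators. -/

variable [CompleteSpace E]

/-- In the functional calculus of a normal operator, functions supported near a point at which
the operator is left invertible modulo compact operators give compact operators. -/
theorem exists_cfcHom_isCompactOperator {N S : E →L[ℂ] E} (hN : IsStarNormal N)
    (z : spectrum ℂ N)
    (hS : IsCompactOperator (S * (N - (z : ℂ) • (1 : E →L[ℂ] E)) - 1 : E →L[ℂ] E)) :
    ∃ f : C(spectrum ℂ N, ℂ), f z ≠ 0 ∧ IsCompactOperator (cfcHom hN f) := by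
  set δ : ℝ := (2 * (‖S‖ + 1))⁻¹ with hδ
  have hδ0 : 0 < δ := by positivity
  have hSδ : ‖S‖ * δ < 1 := by
    rw [hδ, ← div_eq_mul_inv, div_lt_one (by positivity)]
    linarith [norm_nonneg S]
  let u : C(spectrum ℂ N, ℂ) := ⟨fun w => (w : ℂ) - z, by fun_prop⟩
  -- The cutoff `g` is 1 on the `δ`-disc around `z`, outside which `f` vanishes, and keeps `|(w - z)
  -- g(w)| ≤ δ`. Hence `1 - S (u g)(N)` is invertible, and on `f(N)` it acts as `1 - S (N - z)`,
  -- which is compact.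
  let g : C(spectrum ℂ N, ℂ) := ⟨fun w => ((δ / max δ ‖(w : ℂ) - z‖ : ℝ) : ℂ), by
    refine Complex.continuous_ofReal.comp (Continuous.div (by fun_prop) (by fun_prop) fun w => ?_)
    exact (lt_max_of_lt_left hδ0).ne'⟩
  let f : C(spectrum ℂ N, ℂ) := ⟨fun w => ((max 0 (δ - ‖(w : ℂ) - z‖) : ℝ) : ℂ), by fun_prop⟩
  have hgf : g * f = f := by
    ext w
    simp only [ContinuousMap.mul_apply, g, f, ContinuousMap.coe_mk, ← Complex.ofReal_mul]
    rcases le_total δ ‖(w : ℂ) - z‖ with h | h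
    · rw [max_eq_left (sub_nonpos.2 h), mul_zero]
    · rw [max_eq_left h, div_self hδ0.ne', one_mul]
  have hug : ‖u * g‖ ≤ δ := by
    refine (ContinuousMap.norm_le _ hδ0.le).2 fun w => ?_
    have hm : 0 < max δ ‖(w : ℂ) - z‖ := lt_max_of_lt_left hδ0
    simp only [ContinuousMap.mul_apply, u, g, ContinuousMap.coe_mk, norm_mul, Complex.norm_real]
    rw [Real.norm_of_nonneg (by positivity), mul_div_assoc', div_le_iff₀ hm, mul_comm]
    exact mul_le_mul_of_nonneg_left (le_max_right _ _) hδ0.le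
  have hu : cfcHom hN u = N - (z : ℂ) • (1 : E →L[ℂ] E) := by
    have : u = (ContinuousMap.id ℂ).restrict (spectrum ℂ N) - (z : ℂ) • 1 := by
      ext w; simp [u]
    rw [this, map_sub, map_smul, map_one, cfcHom_id]
  have hlt : ‖S * cfcHom hN (u * g)‖ < 1 := by
    refine (norm_mul_le _ _).trans_lt (lt_of_le_of_lt ?_ hSδ)
    refine mul_le_mul_of_nonneg_left ?_ (norm_nonneg S)
    rw [norm_cfcHom N (u * g) hN]
    exact hug
  obtain ⟨U, hU⟩ := isUnit_one_sub_of_norm_lt_one hlt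
  refine ⟨f, by simp [f, hδ0], ?_⟩
  have hcalc : (U : E →L[ℂ] E) * cfcHom hN f =
      -((S * (N - (z : ℂ) • (1 : E →L[ℂ] E)) - 1) * cfcHom hN f) := by
    rw [hU, ← hu, sub_mul, sub_mul, one_mul, mul_assoc S, mul_assoc S, ← map_mul, ← map_mul,
      mul_assoc, hgf, neg_sub]
  have hf : cfcHom hN f = (↑U⁻¹ : E →L[ℂ] E) *
      -((S * (N - (z : ℂ) • (1 : E →L[ℂ] E)) - 1) * cfcHom hN f) := by
    rw [← hcalc, Units.inv_mul_cancel_left]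
  rw [hf]
  exact ((hS.comp_clm (cfcHom hN f)).neg).clm_comp (↑U⁻¹ : E →L[ℂ] E)

/-- A normal operator whose essential spectrum lies in the open unit disc is a strict contraction
up to a compact operator. -/
theorem exists_norm_lt_one_add_isCompactOperator {N : E →L[ℂ] E} (hN : IsStarNormal N)
    (hS : ∀ z : ℂ, 1 ≤ ‖z‖ → ∃ S : E →L[ℂ] E,
      IsCompactOperator (S * (N - z • (1 : E →L[ℂ] E)) - 1 : E →L[ℂ] E)) :
    ∃ L C : E →L[ℂ] E, N = L + C ∧ ‖L‖ < 1 ∧ IsCompactOperator C := by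
  let I : Ideal C(spectrum ℂ N, ℂ) :=
    { carrier := {f | IsCompactOperator (cfcHom hN f)}
      add_mem' := fun {f g} hf hg => by
        simp only [Set.mem_ofPred_eq, map_add] at *
        exact hf.add hg
      zero_mem' := by
        simp only [Set.mem_ofPred_eq, map_zero]
        exact isCompactOperator_zero
      smul_mem' := fun c f hf => by
        simp only [Set.mem_ofPred_eq, smul_eq_mul, map_mul] at *
        exact hf.clm_comp (cfcHom hN c) }
  have hI : IsClosed (I : Set C(spectrum ℂ N, ℂ)) :=
    isClosed_setOfPred_isCompactOperator.preimage (cfcHom_continuous hN)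
  -- A closed ideal consists of all functions vanishing on its common zero set, which plays the role
  -- of the essential spectrum.
  have hIeq := ContinuousMap.idealOfSet_ofIdeal_isClosed hI
  have hZ : IsCompact (ContinuousMap.setOfIdeal I)ᶜ :=
    (ContinuousMap.setOfIdeal_open I).isClosed_compl.isCompact
  have hlt : ∀ z ∈ (ContinuousMap.setOfIdeal I)ᶜ, ‖(z : ℂ)‖ < 1 := by
    intro z hz
    by_contra! h
    obtain ⟨S, hS⟩ := hS z h
    obtain ⟨f, hfz, hf⟩ := exists_cfcHom_isCompactOperator hN z hS
    exact hz (ContinuousMap.mem_setOfIdeal.2 ⟨f, hf, hfz⟩)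
  -- The value 1/2 covers an empty zero set and keeps `c` positive for the division below.
  obtain ⟨c, hc0, hc1, hc⟩ : ∃ c : ℝ, 0 < c ∧ c < 1 ∧
      ∀ z ∈ (ContinuousMap.setOfIdeal I)ᶜ, ‖(z : ℂ)‖ ≤ c := by
    rcases (ContinuousMap.setOfIdeal I)ᶜ.eq_empty_or_nonempty with h | h
    · exact ⟨1 / 2, by norm_num, by norm_num, by simp [h]⟩
    · obtain ⟨z, hz, hmax⟩ := hZ.exists_isMaxOn h
        (f := fun z : spectrum ℂ N => ‖(z : ℂ)‖) (by fun_prop)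
      exact ⟨max (1 / 2) ‖(z : ℂ)‖, by positivity, max_lt (by norm_num) (hlt z hz),
        fun w hw => (hmax hw).trans (le_max_right _ _)⟩
  -- Radial retraction onto the disc of radius `c`: it is the identity on the zero set, so `id - l`
  -- lies in the ideal.
  let l : C(spectrum ℂ N, ℂ) := ⟨fun w => (w : ℂ) * ((c / max c ‖(w : ℂ)‖ : ℝ) : ℂ), by
    refine Continuous.mul (by fun_prop)
      (Complex.continuous_ofReal.comp (Continuous.div (by fun_prop) (by fun_prop) fun w => ?_))
    exact (lt_max_of_lt_left hc0).ne'⟩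
  refine ⟨cfcHom hN l, cfcHom hN ((ContinuousMap.id ℂ).restrict (spectrum ℂ N) - l), ?_, ?_, ?_⟩
  · rw [map_sub, cfcHom_id]
    abel
  · rw [norm_cfcHom N l hN]
    refine lt_of_le_of_lt ((ContinuousMap.norm_le _ hc0.le).2 fun w => ?_) hc1
    have hm : 0 < max c ‖(w : ℂ)‖ := lt_max_of_lt_left hc0
    simp only [l, ContinuousMap.coe_mk, norm_mul, Complex.norm_real]
    rw [Real.norm_of_nonneg (by positivity), mul_div_assoc', div_le_iff₀ hm, mul_comm]
    exact mul_le_mul_of_nonneg_left (le_max_right _ _) hc0.le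
  · change _ ∈ I
    rw [← hIeq, ContinuousMap.mem_idealOfSet]
    intro w hw
    simp only [ContinuousMap.sub_apply, ContinuousMap.restrict_apply, ContinuousMap.id_apply, l,
      ContinuousMap.coe_mk]
    rw [max_eq_left (hc w hw), div_self hc0.ne']
    simp

end Hilbert

/-! ### Real analyticity of determinants and compressions. -/

section Analytic

/-- In a fixed basis the determinant is a polynomial in the entries, which are continuous linear
functionals of the operator. -/
theorem analyticAt_det {V : Type*} [NormedAddCommGroup V] [NormedSpace ℂ V]
    [FiniteDimensional ℂ V] {a : ℝ → V →L[ℂ] V} {θ : ℝ} (ha : AnalyticAt ℝ a θ) :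
    AnalyticAt ℝ (fun t => LinearMap.det (a t : V →ₗ[ℂ] V)) θ := by
  let b := Module.finBasis ℂ V
  have hentry : ∀ i j, AnalyticAt ℝ (fun t => LinearMap.toMatrix b b (a t : V →ₗ[ℂ] V) i j) θ := by
    intro i j
    let ℓ : (V →L[ℂ] V) →L[ℂ] ℂ :=
      (LinearMap.toContinuousLinearMap (b.coord i)) ∘L (ContinuousLinearMap.apply ℂ V (b j))
    have : (fun t => LinearMap.toMatrix b b (a t : V →ₗ[ℂ] V) i j) =
        fun t => (ℓ.restrictScalars ℝ) (a t) := by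
      ext t
      simp [ℓ, LinearMap.toMatrix_apply]
    rw [this]
    exact ((ℓ.restrictScalars ℝ).analyticAt _).comp ha
  have hdet : (fun t => LinearMap.det (a t : V →ₗ[ℂ] V)) =
      fun t => ∑ σ : Equiv.Perm (Fin (Module.finrank ℂ V)),
        ((Equiv.Perm.sign σ : ℤ) : ℂ) * ∏ i, LinearMap.toMatrix b b (a t : V →ₗ[ℂ] V) (σ i) i := by
    ext t
    rw [← LinearMap.det_toMatrix b, Matrix.det_apply']
  rw [hdet]
  refine Finset.analyticAt_fun_sum _ fun σ _ => analyticAt_const.mul ?_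
  exact Finset.analyticAt_fun_prod _ fun i _ => hentry _ _

theorem analyticAt_clm_comp_comp {E V : Type*} [NormedAddCommGroup E] [NormedSpace ℂ E]
    [NormedAddCommGroup V] [NormedSpace ℂ V] (P : E →L[ℂ] V) (J : V →L[ℂ] E)
    {X : ℝ → E →L[ℂ] E} {θ : ℝ} (hX : AnalyticAt ℝ X θ) :
    AnalyticAt ℝ (fun t => P ∘L X t ∘L J) θ := by
  let ℓ : (E →L[ℂ] E) →L[ℂ] (V →L[ℂ] V) :=
    (ContinuousLinearMap.compL ℂ V E V P) ∘L ((ContinuousLinearMap.compL ℂ V E E).flip J)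
  exact ((ℓ.restrictScalars ℝ).analyticAt _).comp hX

end Analytic

/-! ### Null vectors of finite-rank perturbations of invertible operators. -/

section Hilbert

variable {E : Type*} [NormedAddCommGroup E] [InnerProductSpace ℂ E]

theorem norm_inner_apply_le_of_numRange_subset {T : E →L[ℂ] E}
    (hW : numRange T ⊆ Metric.closedBall (0 : ℂ) 1) (x : E) :
    ‖inner ℂ x (T x)‖ ≤ ‖x‖ ^ 2 := by
  rcases eq_or_ne x 0 with rfl | hx
  · simp
  have h := hW (inner_div_mem_numRange T hx)
  have hx' : 0 < ‖x‖ ^ 2 := pow_pos (norm_pos_iff.2 hx) 2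
  rw [mem_closedBall_zero_iff, norm_div, Complex.norm_real, Real.norm_of_nonneg hx'.le,
    div_le_one hx'] at h
  exact h

/-- If `G` is invertible and `F` has finite-dimensional range, approximate unit null vectors of
`G - F` have a unit null vector as a limit point. -/
theorem exists_norm_eq_one_apply_eq_zero {G F : E →L[ℂ] E} (hG : IsUnit G) (V : Submodule ℂ E)
    [FiniteDimensional ℂ V] (hF : ∀ x, F x ∈ V) {x : ℕ → E} (hx : ∀ n, ‖x n‖ = 1)
    (hlim : Tendsto (fun n => (G - F) (x n)) atTop (𝓝 0)) :
    ∃ y, ‖y‖ = 1 ∧ (G - F) y = 0 := by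
  obtain ⟨U, rfl⟩ := hG
  have : ProperSpace V := FiniteDimensional.proper ℂ V
  -- Balls of `V` are compact, so `F (x n)` converges along a subsequence; then so does `G (x n)`,
  -- and inverting `G` gives convergence of `x n` in norm.
  obtain ⟨v, -, φ, hφ, hv⟩ := tendsto_subseq_of_bounded (Metric.isBounded_closedBall
    (x := (0 : V)) (r := ‖F‖)) (x := fun n => ⟨F (x n), hF _⟩) (fun n => by
      rw [mem_closedBall_zero_iff]
      simpa [hx] using F.le_opNorm (x n))
  have hFv : Tendsto (fun n => F (x (φ n))) atTop (𝓝 (v : E)) :=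
    (continuous_subtype_val.tendsto v).comp hv
  have hGv : Tendsto (fun n => (U : E →L[ℂ] E) (x (φ n))) atTop (𝓝 (v : E)) := by
    have := (hlim.comp hφ.tendsto_atTop).add hFv
    simpa using this
  have hxy : Tendsto (fun n => x (φ n)) atTop (𝓝 ((↑U⁻¹ : E →L[ℂ] E) v)) := by
    have := ((↑U⁻¹ : E →L[ℂ] E).continuous.tendsto _).comp hGv
    refine this.congr fun n => ?_
    change (↑U⁻¹ * ↑U : E →L[ℂ] E) _ = _
    rw [U.inv_mul]
    rfl
  refine ⟨(↑U⁻¹ : E →L[ℂ] E) v, ?_, ?_⟩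
  · exact tendsto_nhds_unique hxy.norm (by simp [hx])
  · exact tendsto_nhds_unique (((U - F : E →L[ℂ] E).continuous.tendsto _).comp hxy)
      (hlim.comp hφ.tendsto_atTop)

/-- For `G` invertible and `F` with range in the finite-dimensional space `V`, the kernel of
`G - F` is detected by the determinant of the compression of `1 - F G⁻¹` to `V`. -/
theorem det_compression_eq_zero_iff {G F : E →L[ℂ] E} (hG : IsUnit G) (V : Submodule ℂ E)
    [FiniteDimensional ℂ V] (hF : ∀ x, F x ∈ V) :
    LinearMap.det ((1 - V.orthogonalProjectionOnto ∘L (F * Ring.inverse G) ∘L V.subtypeL :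
      V →L[ℂ] V) : V →ₗ[ℂ] V) = 0 ↔ ∃ x ≠ 0, (G - F) x = 0 := by
  obtain ⟨U, rfl⟩ := hG
  rw [Ring.inverse_unit, LinearMap.det_eq_zero_iff_ker_ne_bot, Submodule.ne_bot_iff]
  have hcomp : ∀ v : V, ((1 - V.orthogonalProjectionOnto ∘L (F * (↑U⁻¹ : E →L[ℂ] E)) ∘L
      V.subtypeL : V →L[ℂ] V) v : E) = v - F ((↑U⁻¹ : E →L[ℂ] E) v) := by
    intro v
    have := Submodule.starProjection_eq_self_iff.2 (hF ((↑U⁻¹ : E →L[ℂ] E) v))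
    rw [Submodule.starProjection_apply] at this
    simp [this]
  have hUU : ∀ y, (U : E →L[ℂ] E) ((↑U⁻¹ : E →L[ℂ] E) y) = y := fun y => by
    change (↑U * ↑U⁻¹ : E →L[ℂ] E) y = y
    rw [U.mul_inv]; rfl
  have hUU' : ∀ y, (↑U⁻¹ : E →L[ℂ] E) ((U : E →L[ℂ] E) y) = y := fun y => by
    change (↑U⁻¹ * ↑U : E →L[ℂ] E) y = y
    rw [U.inv_mul]; rfl
  -- Since `1 - F G⁻¹ = (G - F) G⁻¹`, null vectors correspond by `x = G⁻¹ v`, `v = G x = F x`, and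
  -- such a `v` lies in `V`.
  constructor
  · rintro ⟨v, hv, hv0⟩
    have hv' : (v : E) - F ((↑U⁻¹ : E →L[ℂ] E) v) = 0 := by
      rw [← hcomp v]
      exact congrArg Subtype.val (LinearMap.mem_ker.1 hv)
    refine ⟨(↑U⁻¹ : E →L[ℂ] E) v, fun h => hv0 ?_, ?_⟩
    · have := hUU v
      rw [h, map_zero] at this
      exact Subtype.ext this.symm
    · rw [_root_.sub_apply, hUU, hv']
  · rintro ⟨x, hx0, hx⟩
    rw [_root_.sub_apply, sub_eq_zero] at hx
    refine ⟨⟨F x, hF x⟩, ?_, fun h => hx0 ?_⟩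
    · refine LinearMap.mem_ker.2 (Subtype.ext ?_)
      refine (hcomp _).trans ?_
      change F x - F ((↑U⁻¹ : E →L[ℂ] E) (F x)) = 0
      have : (↑U⁻¹ : E →L[ℂ] E) (F x) = x := by rw [← hx, hUU']
      rw [this, sub_self]
    · have h' : F x = 0 := congrArg Subtype.val h
      rw [← hUU' x, hx, h', map_zero]

/-! ### Rotated real parts and positivity. -/

variable [CompleteSpace E]

/-- The real part of `exp (-iθ) X`. -/
noncomputable def rotatedRe (X : E →L[ℂ] E) (θ : ℝ) : E →L[ℂ] E :=
  (1 / 2 : ℂ) • (Complex.exp (-(θ * Complex.I)) • X +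
    Complex.exp (θ * Complex.I) • ContinuousLinearMap.adjoint X)

theorem rotatedRe_add (X Y : E →L[ℂ] E) (θ : ℝ) :
    rotatedRe (X + Y) θ = rotatedRe X θ + rotatedRe Y θ := by
  simp only [rotatedRe, map_add, smul_add]
  abel

theorem norm_rotatedRe_le (X : E →L[ℂ] E) (θ : ℝ) : ‖rotatedRe X θ‖ ≤ ‖X‖ := by
  have h1 : ‖Complex.exp (-(θ * Complex.I))‖ = 1 := by
    rw [← neg_mul, ← Complex.ofReal_neg, Complex.norm_exp_ofReal_mul_I]
  have h := norm_add_le (Complex.exp (-(θ * Complex.I)) • X)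
    (Complex.exp (θ * Complex.I) • ContinuousLinearMap.adjoint X)
  rw [norm_smul, norm_smul, h1, Complex.norm_exp_ofReal_mul_I, LinearIsometryEquiv.norm_map] at h
  rw [rotatedRe, norm_smul]
  norm_num
  linarith

theorem inner_rotatedRe (X : E →L[ℂ] E) (θ : ℝ) (x : E) :
    inner ℂ x (rotatedRe X θ x) =
      (((Complex.exp (-(θ * Complex.I)) * inner ℂ x (X x)).re : ℝ) : ℂ) := by
  rw [Complex.re_eq_add_conj, map_mul, inner_conj_symm, ← Complex.exp_conj]
  simp only [rotatedRe, _root_.smul_apply, _root_.add_apply,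
    inner_smul_right, inner_add_right, ContinuousLinearMap.adjoint_inner_right, map_neg, map_mul,
    Complex.conj_ofReal, Complex.conj_I, mul_neg, neg_neg]
  ring

theorem analyticAt_rotatedRe (X : E →L[ℂ] E) (θ : ℝ) : AnalyticAt ℝ (rotatedRe X) θ := by
  have hof : AnalyticAt ℝ (fun t : ℝ => (t : ℂ)) θ := Complex.ofRealCLM.analyticAt θ
  have hexp : ∀ z : ℂ, AnalyticAt ℝ Complex.exp z := fun z =>
    (analyticAt_cexp (z := z)).restrictScalars
  have hneg : AnalyticAt ℝ (fun t : ℝ => Complex.exp (-(t * Complex.I))) θ :=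
    (hexp _).comp (f := fun t : ℝ => -((t : ℂ) * Complex.I)) (hof.mul analyticAt_const).neg
  have hpos : AnalyticAt ℝ (fun t : ℝ => Complex.exp (t * Complex.I)) θ :=
    (hexp _).comp (f := fun t : ℝ => (t : ℂ) * Complex.I) (hof.mul analyticAt_const)
  exact (analyticAt_const (v := (1 / 2 : ℂ))).smul ((hneg.smul (analyticAt_const (v := X))).add
    (hpos.smul (analyticAt_const (v := ContinuousLinearMap.adjoint X))))

/-- The closed unit disc lies in each half-plane `Re(e^{-iθ}w) ≤ 1`. -/
theorem isPositive_one_sub_rotatedRe {T : E →L[ℂ] E}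
    (hW : numRange T ⊆ Metric.closedBall (0 : ℂ) 1) (θ : ℝ) :
    (1 - rotatedRe T θ).IsPositive := by
  rw [ContinuousLinearMap.isPositive_iff_complex]
  intro x
  have hin : inner ℂ ((1 - rotatedRe T θ) x) x =
      ((‖x‖ ^ 2 - (Complex.exp (-(θ * Complex.I)) * inner ℂ x (T x)).re : ℝ) : ℂ) := by
    rw [← inner_conj_symm, _root_.sub_apply, inner_sub_right, inner_rotatedRe]
    simp [inner_self_eq_norm_sq_to_K]
  have h1 : ‖Complex.exp (-(θ * Complex.I))‖ = 1 := by
    rw [← neg_mul, ← Complex.ofReal_neg, Complex.norm_exp_ofReal_mul_I]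
  have h2 := Complex.re_le_norm (Complex.exp (-(θ * Complex.I)) * inner ℂ x (T x))
  rw [norm_mul, h1, one_mul] at h2
  rw [hin]
  rw [RCLike.re_eq_complex_re, Complex.ofReal_re]
  exact ⟨rfl, by linarith [norm_inner_apply_le_of_numRange_subset hW x]⟩

/-- With `D = Q²`, the form is `‖Q x‖²` and `‖D x‖ ≤ ‖Q‖ ‖Q x‖`. This turns vanishing of the form
along a sequence into vanishing of `D x` in norm. -/
theorem norm_apply_sq_le_of_isPositive {D : E →L[ℂ] E} (hD : D.IsPositive) :
    ∃ c : ℝ, ∀ x, ‖D x‖ ^ 2 ≤ c * ‖inner ℂ x (D x)‖ := by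
  have hD' : 0 ≤ D := (ContinuousLinearMap.nonneg_iff_isPositive D).2 hD
  have hmul : CFC.sqrt D * CFC.sqrt D = D := CFC.sqrt_mul_sqrt_self D hD'
  have hsa : IsSelfAdjoint (CFC.sqrt D) := (CFC.sqrt_nonneg D).isSelfAdjoint
  set Q := CFC.sqrt D
  refine ⟨‖Q‖ ^ 2, fun x => ?_⟩
  have hQ : ∀ x, D x = Q (Q x) := fun x => by rw [← hmul]; rfl
  have hin : inner ℂ x (D x) = ((‖Q x‖ ^ 2 : ℝ) : ℂ) := by
    rw [hQ, ← ContinuousLinearMap.adjoint_inner_left,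
      ContinuousLinearMap.isSelfAdjoint_iff'.1 hsa, inner_self_eq_norm_sq_to_K]
    simp
  rw [hin, Complex.norm_real, Real.norm_of_nonneg (by positivity), ← mul_pow, hQ]
  gcongr
  exact Q.le_opNorm _

end Hilbert

/-! ### Boundary points of the numerical range and Anderson's theorem. -/

section Hilbert

variable {E : Type*} [NormedAddCommGroup E] [InnerProductSpace ℂ E] [CompleteSpace E]

/-- A null vector gives a point of the numerical range on the tangent line `Re(e^{-iθ}w) = 1`, which
meets the closed disc only at `e^{iθ}`. -/
theorem exp_mem_numRange_of_apply_eq_zero {T : E →L[ℂ] E}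
    (hW : numRange T ⊆ Metric.closedBall (0 : ℂ) 1) {θ : ℝ} {x : E} (hx : x ≠ 0)
    (h : (1 - rotatedRe T θ) x = 0) : Complex.exp (θ * Complex.I) ∈ numRange T := by
  set w : ℂ := inner ℂ x (T x) / ((‖x‖ ^ 2 : ℝ) : ℂ) with hw
  have hmem : w ∈ numRange T := inner_div_mem_numRange T hx
  have hre : (Complex.exp (-(θ * Complex.I)) * w).re = 1 := by
    have hin := inner_rotatedRe T θ x
    have hxx : rotatedRe T θ x = x := by
      rw [_root_.sub_apply, sub_eq_zero] at h
      exact h.symm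
    rw [hxx, inner_self_eq_norm_sq_to_K] at hin
    have hin' : ‖x‖ ^ 2 = (Complex.exp (-(θ * Complex.I)) * inner ℂ x (T x)).re := by
      exact Complex.ofReal_injective ((Complex.ofReal_pow _ _).trans hin)
    rw [hw, mul_div_assoc', Complex.div_ofReal_re, ← hin', div_self]
    exact pow_ne_zero 2 (norm_ne_zero_iff.2 hx)
  have hnorm : ‖Complex.exp (-(θ * Complex.I)) * w‖ ≤ 1 := by
    rw [norm_mul, ← neg_mul, ← Complex.ofReal_neg, Complex.norm_exp_ofReal_mul_I, one_mul]
    exact mem_closedBall_zero_iff.1 (hW hmem)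
  have hone : Complex.exp (-(θ * Complex.I)) * w = 1 := by
    set u := Complex.exp (-(θ * Complex.I)) * w
    have h1 : u.re * u.re + u.im * u.im ≤ 1 := by
      rw [← Complex.normSq_apply, Complex.normSq_eq_norm_sq]
      exact pow_le_one₀ (norm_nonneg _) hnorm
    have him : u.im = 0 := by
      rw [hre] at h1
      nlinarith [mul_self_nonneg u.im]
    exact Complex.ext hre him
  have : w = Complex.exp (θ * Complex.I) := by
    rw [Complex.exp_neg, inv_mul_eq_iff_eq_mul₀ (Complex.exp_ne_zero _), mul_one] at hone
    exact hone
  exact this ▸ hmem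

theorem exists_seq_tendsto_zero_of_exp_mem_closure {T : E →L[ℂ] E}
    (hW : numRange T ⊆ Metric.closedBall (0 : ℂ) 1) {θ : ℝ}
    (h : Complex.exp (θ * Complex.I) ∈ closure (numRange T)) :
    ∃ x : ℕ → E, (∀ n, ‖x n‖ = 1) ∧
      Tendsto (fun n => (1 - rotatedRe T θ) (x n)) atTop (𝓝 0) := by
  obtain ⟨w, hw, hlim⟩ := mem_closure_iff_seq_limit.1 h
  choose x hx hTx using hw
  refine ⟨x, hx, ?_⟩
  obtain ⟨c, hc⟩ := norm_apply_sq_le_of_isPositive (isPositive_one_sub_rotatedRe hW θ)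
  have hin : ∀ n, inner ℂ (x n) ((1 - rotatedRe T θ) (x n)) =
      1 - (((Complex.exp (-(θ * Complex.I)) * w n).re : ℝ) : ℂ) := by
    intro n
    rw [_root_.sub_apply, inner_sub_right, inner_rotatedRe, hTx]
    simp [inner_self_eq_norm_sq_to_K, hx]
  have hre : Tendsto (fun n => c * ‖inner ℂ (x n) ((1 - rotatedRe T θ) (x n))‖) atTop (𝓝 0) := by
    simp only [hin]
    have hcont : Continuous fun v : ℂ =>
        c * ‖1 - (((Complex.exp (-(θ * Complex.I)) * v).re : ℝ) : ℂ)‖ := by fun_prop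
    have := (hcont.tendsto _).comp hlim
    rw [← Complex.exp_add] at this
    simpa [Function.comp_def] using this
  have hsq : Tendsto (fun n => ‖(1 - rotatedRe T θ) (x n)‖ ^ 2) atTop (𝓝 0) :=
    squeeze_zero (fun n => by positivity) (fun n => hc (x n)) hre
  rw [tendsto_zero_iff_norm_tendsto_zero]
  have := hsq.sqrt
  simpa [Real.sqrt_sq] using this

/-- A finite-rank perturbation of a strict contraction whose numerical range lies in the closed
unit disc and has infinitely many limit points on the circle has the closed disc as its numerical
range. -/
theorem numRange_eq_closedBall_of_finiteRank {T L F : E →L[ℂ] E} (hT : T = L + F) (hL : ‖L‖ < 1)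
    (V : Submodule ℂ E) [FiniteDimensional ℂ V] (hF : ∀ x, F x ∈ V)
    (hF' : ∀ x, ContinuousLinearMap.adjoint F x ∈ V)
    (hW : numRange T ⊆ Metric.closedBall (0 : ℂ) 1)
    (hinf : (closure (numRange T) ∩ Metric.sphere (0 : ℂ) 1).Infinite) :
    numRange T = Metric.closedBall (0 : ℂ) 1 := by
  let G : ℝ → E →L[ℂ] E := fun θ => 1 - rotatedRe L θ
  have hG : ∀ θ, IsUnit (G θ) := fun θ =>
    isUnit_one_sub_of_norm_lt_one ((norm_rotatedRe_le L θ).trans_lt hL)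
  have hGF : ∀ θ, 1 - rotatedRe T θ = G θ - rotatedRe F θ := fun θ => by
    rw [hT, rotatedRe_add, sub_add_eq_sub_sub]
  have hFV : ∀ θ x, rotatedRe F θ x ∈ V := fun θ x =>
    V.smul_mem _ (V.add_mem (V.smul_mem _ (hF x)) (V.smul_mem _ (hF' x)))
  let d : ℝ → ℂ := fun θ => LinearMap.det ((1 - V.orthogonalProjectionOnto ∘L
    (rotatedRe F θ * Ring.inverse (G θ)) ∘L V.subtypeL : V →L[ℂ] V) : V →ₗ[ℂ] V)
  have hd : ∀ θ, d θ = 0 ↔ ∃ x ≠ 0, (1 - rotatedRe T θ) x = 0 := fun θ => by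
    rw [hGF]
    exact det_compression_eq_zero_iff (hG θ) V (hFV θ)
  have hda : AnalyticOnNhd ℝ d Set.univ := by
    intro θ _
    refine analyticAt_det ?_
    have hGa : AnalyticAt ℝ G θ := analyticAt_const.sub (analyticAt_rotatedRe L θ)
    have hinv : AnalyticAt ℝ (fun t => Ring.inverse (G t)) θ := by
      obtain ⟨U, hU⟩ := hG θ
      have := analyticAt_inverse (𝕜 := ℝ) U
      rw [hU] at this
      exact this.comp hGa
    have hprod : AnalyticAt ℝ (fun t => rotatedRe F t * Ring.inverse (G t)) θ :=
      (analyticAt_rotatedRe F θ).mul hinv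
    exact analyticAt_const.sub (analyticAt_clm_comp_comp _ _ hprod)
  have hker : ∀ w ∈ closure (numRange T) ∩ Metric.sphere (0 : ℂ) 1, d w.arg = 0 := by
    rintro w ⟨hw, hw1⟩
    have hwe : Complex.exp (w.arg * Complex.I) = w := by
      have := Complex.norm_mul_exp_arg_mul_I w
      rwa [mem_sphere_zero_iff_norm.1 hw1, Complex.ofReal_one, one_mul] at this
    obtain ⟨x, hx, hlim⟩ := exists_seq_tendsto_zero_of_exp_mem_closure hW (hwe.symm ▸ hw)
    rw [hGF] at hlim
    obtain ⟨y, hy, hy0⟩ := exists_norm_eq_one_apply_eq_zero (hG _) V (hFV _) hx hlim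
    rw [hd, hGF]
    exact ⟨y, by rintro rfl; simp at hy, hy0⟩
  have hinj : Set.InjOn Complex.arg (closure (numRange T) ∩ Metric.sphere (0 : ℂ) 1) := by
    intro v hv w hw h
    refine Complex.ext_norm_arg ?_ h
    rw [mem_sphere_zero_iff_norm.1 hv.2, mem_sphere_zero_iff_norm.1 hw.2]
  -- The infinitely many arguments, all zeros of `d`, accumulate in `[-π, π]`; the identity theorem
  -- then gives `d = 0` on the line.
  obtain ⟨θ₀, -, hacc⟩ := (hinf.image hinj).exists_accPt_of_subset_isCompact
    (isCompact_Icc (a := -Real.pi) (b := Real.pi)) (by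
      rintro _ ⟨w, -, rfl⟩
      exact ⟨(Complex.neg_pi_lt_arg w).le, Complex.arg_le_pi w⟩)
  have hzero : Set.EqOn d 0 Set.univ := by
    refine hda.eqOn_zero_of_preconnected_of_frequently_eq_zero isPreconnected_univ
      (Set.mem_univ θ₀) ((accPt_iff_frequently_nhdsNE.1 hacc).mono ?_)
    rintro _ ⟨w, hw, rfl⟩
    exact hker w hw
  have hsph : Metric.sphere (0 : ℂ) 1 ⊆ numRange T := by
    intro w hw
    have hwe : Complex.exp (w.arg * Complex.I) = w := by
      have := Complex.norm_mul_exp_arg_mul_I w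
      rwa [mem_sphere_zero_iff_norm.1 hw, Complex.ofReal_one, one_mul] at this
    obtain ⟨x, hx0, hx⟩ := (hd w.arg).1 (hzero (Set.mem_univ _))
    exact hwe ▸ exp_mem_numRange_of_apply_eq_zero hW hx0 hx
  refine hW.antisymm ?_
  rw [← convexHull_sphere_eq_closedBall (0 : ℂ) zero_le_one]
  exact convexHull_min hsph (convex_numRange T)

/-- Anderson's theorem for compact perturbations of normal operators on a Hilbert space. -/
theorem numRange_eq_closedBall_of_normal_add_compact {T N K : E →L[ℂ] E} (hTNK : T = N + K)
    (hN : IsStarNormal N) (hK : IsCompactOperator K)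
    (hW : numRange T ⊆ Metric.closedBall (0 : ℂ) 1)
    (hess : ∀ z : ℂ, 1 ≤ ‖z‖ → ∃ S : E →L[ℂ] E,
      IsCompactOperator (S * (T - z • (1 : E →L[ℂ] E)) - 1 : E →L[ℂ] E))
    (hinf : (closure (numRange T) ∩ Metric.sphere (0 : ℂ) 1).Infinite) :
    numRange T = Metric.closedBall (0 : ℂ) 1 := by
  obtain ⟨L, C, hNLC, hL, hC⟩ := exists_norm_lt_one_add_isCompactOperator hN fun z hz => by
    obtain ⟨S, hS⟩ := hess z hz
    refine ⟨S, ?_⟩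
    have : S * (N - z • (1 : E →L[ℂ] E)) - 1 = (S * (T - z • (1 : E →L[ℂ] E)) - 1) - S * K := by
      rw [hTNK]
      noncomm_ring
    rw [this]
    exact hS.sub (hK.clm_comp S)
  have hCK : IsCompactOperator (C + K : E →L[ℂ] E) := hC.add hK
  -- An error of half the gap `1 - ‖L‖` can be absorbed into `L`, leaving a strict contraction.
  obtain ⟨V, hV, hVε⟩ := exists_finiteDimensional_norm_sub_starProjection_comp_le hCK
    (ε := (1 - ‖L‖) / 2) (by linarith)
  let F : E →L[ℂ] E := V.starProjection ∘L (C + K)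
  -- `V'` must also contain the range of `F* = (C + K)* P`, where `P` projects onto `V`.
  let V' : Submodule ℂ E := V ⊔ V.map (ContinuousLinearMap.adjoint (C + K) : E →ₗ[ℂ] E)
  refine numRange_eq_closedBall_of_finiteRank (L := L + (C + K - F)) (F := F) ?_ ?_ V' ?_ ?_
    hW hinf
  · rw [hTNK, hNLC]
    abel
  · have := norm_add_le L (C + K - F)
    linarith
  · intro x
    exact Submodule.mem_sup_left (Submodule.starProjection_apply_mem V _)
  · intro x
    refine Submodule.mem_sup_right ⟨V.starProjection x, Submodule.starProjection_apply_mem V _, ?_⟩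
    have : ContinuousLinearMap.adjoint F =
        ContinuousLinearMap.adjoint (C + K) ∘L V.starProjection := by
      rw [ContinuousLinearMap.adjoint_comp,
        ContinuousLinearMap.isSelfAdjoint_iff'.1 (isSelfAdjoint_starProjection V)]
    rw [this]
    rfl

end Hilbert

/-! ### Descent from the semi-inner product to a Hilbert space. -/

section Reduction

variable {H E : Type*} [NormedAddCommGroup H] [InnerProductSpace ℂ H]
  [NormedAddCommGroup E] [InnerProductSpace ℂ E] {A T : H →L[ℂ] H} {B : H →L[ℂ] E}

theorem aNorm_eq_norm (hB : ∀ x y, aInner A x y = inner ℂ (B y) (B x)) (x : H) :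
    aNorm A x = ‖B x‖ := by
  rw [aNorm, hB, inner_self_eq_norm_sq_to_K]
  have : (((‖B x‖ : ℝ) : ℂ) ^ 2).re = ‖B x‖ ^ 2 := by
    rw [← Complex.ofReal_pow, Complex.ofReal_re]
  exact (congrArg Real.sqrt this).trans (Real.sqrt_sq (norm_nonneg _))

/-- An `A`-bounded operator descends along a surjection that realizes the semi-inner product. -/
theorem IsABounded.exists_lift (hT : IsABounded A T)
    (hB : ∀ x y, aInner A x y = inner ℂ (B y) (B x)) (hsurj : Function.Surjective B) :
    ∃ T' : E →L[ℂ] E, ∀ x, T' (B x) = B (T x) := by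
  obtain ⟨c, -, hc⟩ := hT
  simp only [aNorm_eq_norm hB] at hc
  have hwd : ∀ x y, B x = B y → B (T x) = B (T y) := by
    intro x y h
    have := hc (x - y)
    rw [map_sub, map_sub, map_sub, h, sub_self, norm_zero, mul_zero] at this
    exact sub_eq_zero.1 (norm_le_zero_iff.1 this)
  -- The section `s` need not be linear; `hwd` makes `B ∘ T ∘ s` linear anyway.
  let s := Function.surjInv hsurj
  have hs : ∀ u, B (s u) = u := Function.surjInv_eq hsurj
  let f : E →ₗ[ℂ] E :=
    { toFun := fun u => B (T (s u))
      map_add' := fun u v => by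
        rw [← map_add, ← map_add]
        exact hwd _ _ (by rw [map_add, hs, hs, hs])
      map_smul' := fun a u => by
        rw [RingHom.id_apply, ← map_smul, ← map_smul]
        exact hwd _ _ (by rw [map_smul, hs, hs]) }
  refine ⟨f.mkContinuous c fun u => ?_, fun x => hwd _ _ (hs _)⟩
  have := hc (s u)
  rwa [hs] at this

theorem aNumRange_eq_numRange (hB : ∀ x y, aInner A x y = inner ℂ (B y) (B x))
    (hsurj : Function.Surjective B) {T' : E →L[ℂ] E} (hT' : ∀ x, T' (B x) = B (T x)) :
    aNumRange A T = numRange T' := by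
  ext w
  constructor
  · rintro ⟨x, hx, rfl⟩
    exact ⟨B x, by rw [← aNorm_eq_norm hB, hx], by rw [hT', hB]⟩
  · rintro ⟨u, hu, rfl⟩
    obtain ⟨x, rfl⟩ := hsurj u
    exact ⟨x, by rw [aNorm_eq_norm hB, hu], by rw [hT', hB]⟩

theorem IsACompact.isCompactOperator_lift (hT : IsACompact A T)
    (hB : ∀ x y, aInner A x y = inner ℂ (B y) (B x)) (hsurj : Function.Surjective B)
    {T' : E →L[ℂ] E} (hT' : ∀ x, T' (B x) = B (T x)) : IsCompactOperator T' := by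
  refine (isCompactOperator_iff_isCompact_closure_image_closedBall (T' : E →ₗ[ℂ] E)
    one_pos).2 ?_
  refine IsSeqCompact.isCompact fun y hy => ?_
  -- Points of the closure are replaced by true images with error `1/(n+1)`, to which
  -- `A`-compactness applies.
  have hv : ∀ n : ℕ, ∃ x : H, ‖B x‖ ≤ 1 ∧ dist (y n) (B (T x)) < 1 / ((n : ℝ) + 1) := by
    intro n
    obtain ⟨_, ⟨u, hu, rfl⟩, hd⟩ := Metric.mem_closure_iff.1 (hy n) _ Nat.one_div_pos_of_nat
    obtain ⟨x, rfl⟩ := hsurj u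
    exact ⟨x, mem_closedBall_zero_iff.1 hu, by rw [← hT']; exact hd⟩
  choose x hx hxy using hv
  obtain ⟨z, φ, hφ, hlim⟩ := hT.2 x ⟨1, fun n => by rw [aNorm_eq_norm hB]; exact hx n⟩
  have hy' : Tendsto (fun n => y (φ n)) atTop (𝓝 (B z)) := by
    simp only [aNorm_eq_norm hB, map_sub] at hlim
    refine tendsto_iff_dist_tendsto_zero.2 (squeeze_zero (fun n => dist_nonneg)
      (fun n => dist_triangle _ (B (T (x (φ n)))) _) ?_)
    have h1 : Tendsto (fun n => dist (y (φ n)) (B (T (x (φ n))))) atTop (𝓝 0) :=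
      squeeze_zero (fun n => dist_nonneg) (fun n => (hxy (φ n)).le)
        (tendsto_one_div_add_atTop_nhds_zero_nat.comp hφ.tendsto_atTop)
    simpa [dist_eq_norm] using h1.add hlim
  exact ⟨B z, isClosed_closure.mem_of_tendsto hy' (Eventually.of_forall fun n => hy _), φ, hφ, hy'⟩

/-- The `A`-adjoint descends to the Hilbert adjoint, and since `ker A ⊆ ker B` the factor `A` in the
commutation relation can be dropped. -/
theorem IsANormal.isStarNormal_lift [CompleteSpace E] (hT : IsANormal A T)
    (hA : ∀ x y, A x = A y → B x = B y)
    (hB : ∀ x y, aInner A x y = inner ℂ (B y) (B x)) (hsurj : Function.Surjective B)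
    {T' : E →L[ℂ] E} (hT' : ∀ x, T' (B x) = B (T x)) : IsStarNormal T' := by
  obtain ⟨S, ⟨hS, -⟩, hcomm⟩ := hT
  have hadj : ∀ y, ContinuousLinearMap.adjoint T' (B y) = B (S y) := by
    intro y
    refine ext_inner_right ℂ fun u => ?_
    obtain ⟨x, rfl⟩ := hsurj u
    rw [ContinuousLinearMap.adjoint_inner_left, hT', ← hB, ← hB, hS]
  refine ⟨?_⟩
  rw [ContinuousLinearMap.star_eq_adjoint]
  ext u
  obtain ⟨x, rfl⟩ := hsurj u
  change ContinuousLinearMap.adjoint T' (T' (B x)) = T' (ContinuousLinearMap.adjoint T' (B x))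
  rw [hT', hadj, hadj, hT']
  exact hA _ _ (DFunLike.congr_fun hcomm x)

theorem IsAFredholm.exists_lift_left_inverse (hT : IsAFredholm A T)
    (hA : ∀ x y, A x = A y → B x = B y)
    (hB : ∀ x y, aInner A x y = inner ℂ (B y) (B x)) (hsurj : Function.Surjective B)
    {T' : E →L[ℂ] E} (hT' : ∀ x, T' (B x) = B (T x)) :
    ∃ S' : E →L[ℂ] E, IsCompactOperator (S' * T' - 1 : E →L[ℂ] E) := by
  obtain ⟨-, S, -, K, hS, -, hK, -, hST⟩ := hT
  obtain ⟨S', hS'⟩ := hS.exists_lift hB hsurj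
  refine ⟨S', hK.isCompactOperator_lift hB hsurj fun x => ?_⟩
  have h : A (S (T x) - x) = A (K x) := by
    rw [map_sub]
    exact DFunLike.congr_fun hST x
  change S' (T' (B x)) - B x = B (K x)
  rw [hT', hS', ← map_sub]
  exact hA _ _ h

variable [CompleteSpace H]

/-- The ranges of `√A` and `A` coincide: `√A` kills `(R(A))ᗮ`, so by self-adjointness its range lies
in `(R(A))ᗮᗮ`, which is `R(A)` because that is closed. -/
theorem isClosed_range_sqrt (hA : A.IsPositive) (hAcl : IsClosed (Set.range A)) :
    IsClosed (Set.range (CFC.sqrt A : H →L[ℂ] H)) := by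
  have hA' : 0 ≤ A := (ContinuousLinearMap.nonneg_iff_isPositive A).2 hA
  have hmul : CFC.sqrt A * CFC.sqrt A = A := CFC.sqrt_mul_sqrt_self A hA'
  have hsa := ContinuousLinearMap.isSelfAdjoint_iff'.1 (CFC.sqrt_nonneg A).isSelfAdjoint
  set Q := CFC.sqrt A
  have hQ : ∀ x, A x = Q (Q x) := fun x => by rw [← hmul]; rfl
  have hQin : ∀ x y, inner ℂ (Q x) y = inner ℂ x (Q y) := fun x y => by
    rw [← ContinuousLinearMap.adjoint_inner_right, hsa]
  suffices h : Set.range Q = Set.range A by rwa [h]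
  refine Set.Subset.antisymm ?_ ?_
  · rintro _ ⟨x, rfl⟩
    let R : Submodule ℂ H := LinearMap.range (A : H →ₗ[ℂ] H)
    have hR : IsClosed (R : Set H) := by simpa [R, LinearMap.coe_range] using hAcl
    have : CompleteSpace R := hR.completeSpace_coe
    have hmem : Q x ∈ Rᗮᗮ := by
      rw [Submodule.mem_orthogonal]
      intro v hv
      -- Orthogonality of `v` to `A (A v)` says `‖A v‖² = 0`.
      have h0 : inner ℂ (Q (Q v)) (Q (Q v)) = (0 : ℂ) := by
        rw [← hQ v]
        rw [Submodule.mem_orthogonal'] at hv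
        have := hv (A (A v)) ⟨A v, rfl⟩
        rwa [hQ (A v), ← hQin, ← hQin, ← hQ] at this
      have h1 : Q (Q v) = 0 := inner_self_eq_zero.1 h0
      have h2 : Q v = 0 := by
        rw [← inner_self_eq_zero (𝕜 := ℂ), hQin, h1, inner_zero_right]
      rw [← hQin, h2, inner_zero_left]
    rw [Submodule.orthogonal_orthogonal] at hmem
    exact hmem
  · rintro _ ⟨x, rfl⟩
    exact ⟨Q x, (hQ x).symm⟩

end Reduction

end SemiHilbert

/-! ### The theorem for the semi-inner product. -/

theorem mainTheorem2 {H : Type*} [NormedAddCommGroup H] [InnerProductSpace ℂ H] [CompleteSpace H]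
    (A T N K : H →L[ℂ] H) (hA : A.IsPositive) (hAcl : IsClosed (Set.range A))
    (hT : SemiHilbert.IsABounded A T) (hTNK : T = N + K)
    (hN : SemiHilbert.IsANormal A N) (hK : SemiHilbert.IsACompact A K)
    (hW : SemiHilbert.aNumRange A T ⊆ Metric.closedBall (0 : ℂ) 1)
    (hess : SemiHilbert.aEssSpectrum A T ⊆ Metric.ball (0 : ℂ) 1)
    (hinf : (closure (SemiHilbert.aNumRange A T) ∩ Metric.sphere (0 : ℂ) 1).Infinite) :
    SemiHilbert.aNumRange A T = Metric.closedBall (0 : ℂ) 1 := by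
  have hmul : CFC.sqrt A * CFC.sqrt A = A :=
    CFC.sqrt_mul_sqrt_self A ((ContinuousLinearMap.nonneg_iff_isPositive A).2 hA)
  have hsa := ContinuousLinearMap.isSelfAdjoint_iff'.1 (CFC.sqrt_nonneg A).isSelfAdjoint
  have hcl := SemiHilbert.isClosed_range_sqrt hA hAcl
  set Q := CFC.sqrt A
  let E : Submodule ℂ H := LinearMap.range (Q : H →ₗ[ℂ] H)
  have hE : IsClosed (E : Set H) := by simpa [E, LinearMap.coe_range] using hcl
  have : CompleteSpace E := hE.completeSpace_coe
  let B : H →L[ℂ] E := Q.codRestrict E fun x => ⟨x, rfl⟩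
  have hsurj : Function.Surjective B := by
    rintro ⟨_, x, rfl⟩
    exact ⟨x, rfl⟩
  have hB : ∀ x y, SemiHilbert.aInner A x y = inner ℂ (B y) (B x) := by
    intro x y
    change inner ℂ y (A x) = inner ℂ (Q y) (Q x)
    rw [← ContinuousLinearMap.adjoint_inner_right, hsa, ← hmul]
    rfl
  have hAB : ∀ x y, A x = A y → B x = B y := by
    intro x y h
    rw [← sub_eq_zero, ← map_sub, ← inner_self_eq_zero (𝕜 := ℂ), ← hB, SemiHilbert.aInner,
      map_sub, h, sub_self, inner_zero_right]
  obtain ⟨T', hT'⟩ := hT.exists_lift hB hsurj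
  obtain ⟨K', hK'⟩ := hK.1.exists_lift hB hsurj
  -- The normal part on `E` is obtained as a difference of lifts.
  have hN' : ∀ x, (T' - K') (B x) = B (N x) := by
    intro x
    rw [sub_apply, hT', hK', hTNK, ← map_sub]
    simp
  rw [SemiHilbert.aNumRange_eq_numRange hB hsurj hT'] at hW hinf ⊢
  refine SemiHilbert.numRange_eq_closedBall_of_normal_add_compact (sub_add_cancel T' K').symm
    (hN.isStarNormal_lift hAB hB hsurj hN') (hK.isCompactOperator_lift hB hsurj hK') hW
    (fun z hz => ?_) hinf
  have hF : SemiHilbert.IsAFredholm A (T - z • ContinuousLinearMap.id ℂ H) := by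
    by_contra h
    exact absurd (mem_ball_zero_iff.1 (hess h)) hz.not_gt
  refine hF.exists_lift_left_inverse hAB hB hsurj fun x => ?_
  rw [sub_apply, hT']
  simp
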